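/- Let $q$ be a prime power and let $\mathscr Q_n$ be a non-singular quadric in $\mathrm{PG}(n,q)$ of projective index $g\ge 1$ (the largest dimension of a subspace contained in $\mathscr Q_n$). Let $\Gamma$ be its point-graph: the vertices are the points of $\mathscr Q_n$, and two distinct points are adjacent when the line joining them is contained in $\mathscr Q_n$. Let $0\le s<g$ and let $\alpha_s$ be an $s$-dimensional subspace contained in $\mathscr Q_n$. Let $\mathcal X_s$ be the set of points of $\mathscr Q_n\setminus\alpha_s$ that lie in some $(s+1)$-dimensional subspace $\Pi$ with $\alpha_s\subset\Pi\subset\mathscr Q_n$, and let $\mathcal Y_s$ be the set of all other points of $\mathscr Q_n$. Then $\{\mathcal X_s,\mathcal Y_s\}$ is a partition of the vertices of $\Gamma$ into two non-empty sets. Call a partition $\{\mathcal X,\mathcal Y\}$ of the vertices of a finite graph a Godsil–McKay partition if $\mathcal X$ induces a regular subgraph and every vertex in $\mathcal Y$ is adjacent to $0$, $\frac12|\mathcal X|$ or $|\mathcal X|$ vertices in $\mathcal X$. (a) If $q=2$, then $\{\mathcal X_s,\mathcal Y_s\}$ is a Godsil–McKay partition of $\Gamma$. Moreover, let $\Gamma_s$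 be the graph with the same vertices and edges as $\Gamma$, except that for each $R\in\mathcal Y_s$ with exactly $\frac12|\mathcal X_s|$ neighbours in $\mathcal X_s$, these $\frac12|\mathcal X_s|$ edges are deleted and $R$ is joined to the other $\frac12|\mathcal X_s|$ vertices in $\mathcal X_s$. Then $\Gamma$ is strongly regular, and $\Gamma_s$ is strongly regular with the same parameters $(v,k,\lambda,\mu)$ as $\Gamma$. (b) If $q\ne 2$, then $\{\mathcal X_s,\mathcal Y_s\}$ is not a Godsil–McKay partition of $\Gamma$. -/

import Mathlib

open scoped LinearAlgebra.Projectivization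

noncomputable section

namespace GMQuadric

/-! ### Graphs: strong regularity, Godsil-McKay partitions and switching -/

/-- `G` is a strongly regular graph with parameters `(v, k, l, m)` (the choice of the instances
does not matter, everything being classical). -/
def IsSRG {V : Type*} [Finite V] (G : SimpleGraph V) (v k l m : ℕ) : Prop :=
  letI := Fintype.ofFinite V
  letI := Classical.decEq V
  letI := Classical.decRel G.Adj
  G.IsSRGWith v k l m

/-- `{X, Y}` is a partition of the set `V` into two (non-empty) sets. -/
structure IsTwoPartition {V : Type*} (X Y : Set V) : Prop where
  nonempty_left : X.Nonempty
  nonempty_right : Y.Nonempty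
  disjoint : Disjoint X Y
  union_eq : X ∪ Y = Set.univ

/-- The number of vertices of `X` adjacent to the vertex `R`. -/
def nbrCount {V : Type*} (G : SimpleGraph V) (X : Set V) (R : V) : ℕ :=
  (G.neighborSet R ∩ X).ncard

/-- A Godsil-McKay partition `{X, Y}` of a (finite) graph: `X` induces a regular subgraph, and each
vertex of `Y` is adjacent to `0`, `|X|/2` or `|X|` vertices of `X`. -/
structure IsGodsilMcKayPartition {V : Type*} (G : SimpleGraph V) (X Y : Set V) : Prop where
  partition : IsTwoPartition X Y
  regular : ∃ k : ℕ, ∀ P ∈ X, nbrCount G X P = k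
  count : ∀ R ∈ Y, nbrCount G X R = 0 ∨ 2 * nbrCount G X R = X.ncard ∨ nbrCount G X R = X.ncard

/-- The ordered pair `(R, S)` is affected by the switching: `R` is a vertex of `Y` with exactly
`|X|/2` neighbours in `X`, and `S` is a vertex of `X`. -/
def Switches {V : Type*} (G : SimpleGraph V) (X Y : Set V) (R S : V) : Prop :=
  R ∈ Y ∧ 2 * nbrCount G X R = X.ncard ∧ S ∈ X

/-- The Godsil-McKay construction: the graph with the same vertices and edges as `G`, except that
for each vertex `R` of `Y` with exactly `|X|/2` neighbours in `X`, the edges from `R` to `X` are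
deleted and `R` is joined to the vertices of `X` it was not adjacent to in `G`. -/
def switchedGraph {V : Type*} (G : SimpleGraph V) (X Y : Set V) : SimpleGraph V where
  Adj R S := R ≠ S ∧
    (((Switches G X Y R S ∨ Switches G X Y S R) ∧ ¬ G.Adj R S) ∨
      (¬ (Switches G X Y R S ∨ Switches G X Y S R) ∧ G.Adj R S))
  symm := ⟨fun R S h => by
    rwa [ne_comm, or_comm (a := Switches G X Y S R), G.adj_comm S R]⟩
  loopless := ⟨fun _ h => h.1 rfl⟩

/-! ### Quadrics in `PG(n, q)`

`PG(n, F)` is the projective space of `F ^ (n + 1)`; its `d`-dimensional (projective) subspaces are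
the linear subspaces of `F ^ (n + 1)` of linear dimension `d + 1`. -/

section Quadric

variable {F : Type*} [Field F] {n : ℕ}

/-- The quadric of `Q` is non-singular: the form `Q` cannot be written, after a linear change of
coordinates, in fewer variables; equivalently the quadric has no singular point, i.e. there is
no `v ≠ 0` with `Q v = 0` and `Q (v + w) = Q w` for all `w`. -/
def IsNonsingular (Q : QuadraticForm F (Fin (n + 1) → F)) : Prop :=
  Q.radical = ⊥

/-- All the points of the subspace `W` lie on the quadric of `Q`. -/
def IsContained (Q : QuadraticForm F (Fin (n + 1) → F)) (W : Submodule F (Fin (n + 1) → F)) :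
    Prop :=
  ∀ v ∈ W, Q v = 0

/-- `W` is a subspace of projective dimension `d` contained in the quadric of `Q`. -/
def IsSpaceOf (Q : QuadraticForm F (Fin (n + 1) → F)) (d : ℕ)
    (W : Submodule F (Fin (n + 1) → F)) : Prop :=
  Module.finrank F W = d + 1 ∧ IsContained Q W

/-- `g` is the projective index of the quadric: the largest (projective) dimension of a subspace
contained in it. -/
def HasProjectiveIndex (Q : QuadraticForm F (Fin (n + 1) → F)) (g : ℕ) : Prop :=
  IsGreatest {d : ℕ | ∃ W, IsSpaceOf Q d W} g

/-- The points of `PG(n, F)` that lie on the quadric of `Q`. -/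
abbrev QuadricPoint (Q : QuadraticForm F (Fin (n + 1) → F)) : Type _ :=
  {P : ℙ F (Fin (n + 1) → F) // IsContained Q P.submodule}

/-- The point-graph of the quadric: two distinct points `P`, `P'` of the quadric are adjacent if
the line `PP'` joining them is contained in the quadric. -/
def pointGraph (Q : QuadraticForm F (Fin (n + 1) → F)) : SimpleGraph (QuadricPoint Q) where
  Adj P P' := P ≠ P' ∧ IsContained Q (P.1.submodule ⊔ P'.1.submodule)
  symm := ⟨fun P P' h => by rwa [ne_comm, sup_comm]⟩
  loopless := ⟨fun _ h => h.1 rfl⟩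

/-- Type (i): the points in `α`. -/
def typeOne (Q : QuadraticForm F (Fin (n + 1) → F)) (α : Submodule F (Fin (n + 1) → F)) :
    Set (QuadricPoint Q) :=
  {P | P.1.submodule ≤ α}

/-- Type (ii): the points of the quadric not in `α` that lie in some subspace of projective
dimension `s + 1` containing `α` and contained in the quadric. -/
def typeTwo (Q : QuadraticForm F (Fin (n + 1) → F)) (s : ℕ)
    (α : Submodule F (Fin (n + 1) → F)) : Set (QuadricPoint Q) :=
  {P | ¬ P.1.submodule ≤ α ∧ ∃ W, IsSpaceOf Q (s + 1) W ∧ α ≤ W ∧ P.1.submodule ≤ W}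

/-- Type (iii): the remaining points of the quadric. -/
def typeThree (Q : QuadraticForm F (Fin (n + 1) → F)) (s : ℕ)
    (α : Submodule F (Fin (n + 1) → F)) : Set (QuadricPoint Q) :=
  (typeOne Q α ∪ typeTwo Q s α)ᶜ

/-- The part `X_s` of the partition: the points of type (ii). -/
def partX (Q : QuadraticForm F (Fin (n + 1) → F)) (s : ℕ)
    (α : Submodule F (Fin (n + 1) → F)) : Set (QuadricPoint Q) :=
  typeTwo Q s α

/-- The part `Y_s` of the partition: the points of types (i) and (iii). -/
def partY (Q : QuadraticForm F (Fin (n + 1) → F)) (s : ℕ)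
    (α : Submodule F (Fin (n + 1) → F)) : Set (QuadricPoint Q) :=
  typeOne Q α ∪ typeThree Q s α

/-- The graph `Γ_s` obtained from the point-graph by the Godsil-McKay construction with the
partition `{X_s, Y_s}`. -/
def graphGamma (Q : QuadraticForm F (Fin (n + 1) → F)) (s : ℕ)
    (α : Submodule F (Fin (n + 1) → F)) : SimpleGraph (QuadricPoint Q) :=
  switchedGraph (pointGraph Q) (partX Q s α) (partY Q s α)

end Quadric

end GMQuadric

end

/-! Write `B` for the polar form of `Q`. A point `P` outside `α` lies in `X_s` exactly when `P` is
orthogonal to `α` under `B` (`mem_partX`), and adjacency of distinct points is orthogonality.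
Everything becomes counting singular vectors.

For `q = 2`, points are nonzero singular vectors, and translations count them. If `a ∈ α` is not
orthogonal to `R`, then `v ↦ v + a` preserves the vectors of `X_s` and flips orthogonality to `R`,
so `R` sees half of `X_s`; a point of `Y_s` orthogonal to `α` lies in `α` and sees all of it. For a
singular `p ∈ α^⊥` outside `α`, half of `α^⊥` is not orthogonal to `p`, and `v ↦ v + p` flips `Q` on
that half. Hence the number of singular vectors of `α^⊥` orthogonal to `p` does not depend on `p`
(`four_mul_ncard_add`). This gives regularity on `X_s` and, with `α` zero or a point, the strong
regularity of `Γ`.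

Switching conjugates the adjacency matrix by an involution `S` that fixes the all-ones matrix, so
the quadratic equation expressing strong regularity survives (`isSRG_switchedGraph`).

For general `q`, exactly one vector of each coset `v + F a` is orthogonal to `R`, so `R` sees `|X_s|
/ q` points of `X_s` (`nbrCount_mul_card`). For `q ≠ 2` this is none of the allowed values. -/

open scoped LinearAlgebra.Projectivization

noncomputable section

namespace GMQuadric

/-! ### Strong regularity as a matrix equation. -/

section Graph

variable {V : Type*}

/-- Strong regularity in terms of cardinalities of sets. -/
theorem isSRG_iff [Finite V] (G : SimpleGraph V) (v k l m : ℕ) :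
    IsSRG G v k l m ↔ Nat.card V = v ∧ (∀ P, (G.neighborSet P).ncard = k) ∧
      (∀ P R, G.Adj P R → (G.neighborSet P ∩ G.neighborSet R).ncard = l) ∧
      (∀ P R, P ≠ R → ¬ G.Adj P R → (G.neighborSet P ∩ G.neighborSet R).ncard = m) := by
  let := Fintype.ofFinite V
  let := Classical.decEq V
  let := Classical.decRel G.Adj
  have hd : ∀ P, (G.neighborSet P).ncard = G.degree P := fun P => by
    rw [← G.card_neighborSet_eq_degree, Set.ncard_eq_toFinset_card', Set.toFinset_card]
  have hc : ∀ P R, (G.neighborSet P ∩ G.neighborSet R).ncard =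
      Fintype.card (G.commonNeighbors P R) := fun P R => by
    rw [← Nat.card_eq_fintype_card]; rfl
  simp only [hd, hc, Nat.card_eq_fintype_card]
  constructor
  · rintro ⟨h1, h2, h3, h4⟩
    exact ⟨h1, h2, h3, fun P R h => h4 h⟩
  · rintro ⟨h1, h2, h3, h4⟩
    exact ⟨h1, h2, h3, fun P R h => h4 P R h⟩

/-- The rational indicator of a proposition. -/
def ind (p : Prop) : ℚ := by
  classical exact if p then 1 else 0

theorem ind_true {p : Prop} (h : p) : ind p = 1 := if_pos h

theorem ind_false {p : Prop} (h : ¬ p) : ind p = 0 := if_neg h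

theorem ind_and (p q : Prop) : ind p * ind q = ind (p ∧ q) := by
  by_cases hp : p <;> by_cases hq : q <;> simp [ind, hp, hq]

theorem sum_ind [Fintype V] (p : V → Prop) : ∑ x, ind (p x) = ({x | p x}.ncard : ℚ) := by
  classical
  simp only [ind]
  rw [Finset.sum_boole, Set.ncard_eq_toFinset_card']
  simp

/-- The rational adjacency matrix. -/
def adjM (G : SimpleGraph V) : Matrix V V ℚ := fun i j => ind (G.Adj i j)

variable (V) in
/-- The all-ones matrix. -/
def onesM : Matrix V V ℚ := Matrix.of fun _ _ => 1

theorem onesM_apply (i j : V) : onesM V i j = 1 := rfl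

/-- The right-hand side of the quadratic equation of a strongly regular graph. -/
def srgM (A : Matrix V V ℚ) (k l m : ℕ) : Matrix V V ℚ :=
  letI := Classical.decEq V
  (k : ℚ) • (1 : Matrix V V ℚ) + (l : ℚ) • A + (m : ℚ) • (onesM V - 1 - A)

theorem adjM_mul_adjM [Fintype V] (G : SimpleGraph V) (i j : V) :
    (adjM G * adjM G) i j = ((G.neighborSet i ∩ G.neighborSet j).ncard : ℚ) := by
  rw [Matrix.mul_apply]
  simp only [adjM, ind_and]
  rw [sum_ind]
  congr 2
  ext x
  simp [G.adj_comm x j]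

/-- The equation `A² = kI + lA + m(J - I - A)` is read on the diagonal, on edges and on non-edges.
-/
theorem isSRG_iff_matrix [Fintype V] (G : SimpleGraph V) (v k l m : ℕ) :
    IsSRG G v k l m ↔ Nat.card V = v ∧ adjM G * adjM G = srgM (adjM G) k l m := by
  let := Classical.decEq V
  rw [isSRG_iff]
  refine and_congr_right fun _ => ?_
  have hd : ∀ i, srgM (adjM G) k l m i i = k := fun i => by
    simp [srgM, onesM_apply, adjM, ind_false]
  have ha : ∀ i j, G.Adj i j → srgM (adjM G) k l m i j = l := fun i j h => by
    simp [srgM, onesM_apply, adjM, ind_true h, Matrix.one_apply_ne h.ne]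
  have hn : ∀ i j, i ≠ j → ¬ G.Adj i j → srgM (adjM G) k l m i j = m := fun i j h h' => by
    simp [srgM, onesM_apply, adjM, ind_false h', Matrix.one_apply_ne h]
  constructor
  · rintro ⟨h2, h3, h4⟩
    ext i j
    rw [adjM_mul_adjM]
    by_cases hij : i = j
    · subst hij
      rw [hd, Set.inter_self, h2]
    · by_cases h : G.Adj i j
      · rw [ha i j h, h3 i j h]
      · rw [hn i j hij h, h4 i j hij h]
  · intro h
    have h' : ∀ i j, ((G.neighborSet i ∩ G.neighborSet j).ncard : ℚ) =
        srgM (adjM G) k l m i j := fun i j => by rw [← adjM_mul_adjM, h]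
    refine ⟨fun P => ?_, fun P R hPR => ?_, fun P R hPR hPR' => ?_⟩
    · have := h' P P
      rw [hd, Set.inter_self] at this
      exact_mod_cast this
    · have := h' P R
      rw [ha P R hPR] at this
      exact_mod_cast this
    · have := h' P R
      rw [hn P R hPR hPR'] at this
      exact_mod_cast this

/-! ### Godsil-McKay switching as conjugation by an involution. -/

/-- The matrix conjugating the adjacency matrix of a graph to the one of the switched graph. -/
def switchM (X : Set V) : Matrix V V ℚ :=
  letI := Classical.decEq V
  fun i j => (if i = j then 1 - 2 * ind (j ∈ X) else 0) +
    2 / (X.ncard : ℚ) * (ind (i ∈ X) * ind (j ∈ X))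

theorem sum_switchM_mul [Fintype V] (X : Set V) (f : V → ℚ) (i : V) :
    ∑ x, switchM X i x * f x = (1 - 2 * ind (i ∈ X)) * f i +
      2 / (X.ncard : ℚ) * ind (i ∈ X) * ∑ x, ind (x ∈ X) * f x := by
  let := Classical.decEq V
  simp only [switchM, add_mul, Finset.sum_add_distrib, ite_mul, zero_mul, Finset.sum_ite_eq,
    Finset.mem_univ, if_true, Finset.mul_sum]
  congr 1
  exact Finset.sum_congr rfl fun x _ => by ring

theorem switchM_comm (X : Set V) (i j : V) : switchM X i j = switchM X j i := by
  by_cases h : i = j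
  · subst h; rfl
  · simp [switchM, h, Ne.symm h, mul_comm]

theorem sum_mul_switchM [Fintype V] (X : Set V) (f : V → ℚ) (j : V) :
    ∑ x, f x * switchM X x j = (1 - 2 * ind (j ∈ X)) * f j +
      2 / (X.ncard : ℚ) * ind (j ∈ X) * ∑ x, ind (x ∈ X) * f x := by
  rw [← sum_switchM_mul]
  exact Finset.sum_congr rfl fun x _ => by rw [switchM_comm, mul_comm]

theorem sum_ind_mem [Fintype V] (X : Set V) : ∑ x, ind (x ∈ X) = (X.ncard : ℚ) := sum_ind _

theorem ncard_ne_zero_rat [Finite V] {X : Set V} (hX : X.Nonempty) : (X.ncard : ℚ) ≠ 0 :=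
  Nat.cast_ne_zero.2 ((Set.ncard_pos).2 hX).ne'

/-- Every column sums to 1: on `X` the sum is `2 - 1`, off `X` the column is that of the identity.
-/
theorem ones_mul_switchM [Fintype V] {X : Set V} (hX : X.Nonempty) :
    onesM V * switchM X = onesM V := by
  ext i j
  have := ncard_ne_zero_rat hX
  rw [Matrix.mul_apply, sum_mul_switchM]
  simp only [onesM_apply, mul_one, sum_ind_mem]
  field_simp
  ring

theorem switchM_mul_ones [Fintype V] {X : Set V} (hX : X.Nonempty) :
    switchM X * onesM V = onesM V := by
  ext i j
  have := ncard_ne_zero_rat hX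
  rw [Matrix.mul_apply, sum_switchM_mul]
  simp only [onesM_apply, mul_one, sum_ind_mem]
  field_simp
  ring

theorem ind_mul_self (p : Prop) : ind p * ind p = ind p := by simp [ind_and]

/-- The block on `X` is `(2/|X|) J - I`, whose square is `I` because `J² = |X| J` there; off `X` the
matrix is the identity. -/
theorem switchM_mul_self [Fintype V] [DecidableEq V] {X : Set V} (hX : X.Nonempty) :
    switchM X * switchM X = 1 := by
  ext i j
  have hc := ncard_ne_zero_rat hX
  rw [Matrix.mul_apply, sum_switchM_mul, sum_mul_switchM]
  simp only [ind_mul_self, sum_ind_mem]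
  have hi := ind_mul_self (i ∈ X)
  by_cases hij : i = j
  · subst hij
    by_cases h : i ∈ X
    · simp only [switchM, if_true, ind_true h, Matrix.one_apply_eq]; field_simp; ring
    · simp [switchM, ind_false h]
  · simp only [switchM, hij, if_false, Matrix.one_apply_ne hij]
    by_cases h : i ∈ X <;> by_cases h' : j ∈ X
    · simp only [ind_true h, ind_true h']; field_simp; ring
    · simp [ind_true h, ind_false h']
    · simp [ind_false h, ind_true h']
    · simp [ind_false h, ind_false h']

theorem sum_ind_mul_adj [Fintype V] (G : SimpleGraph V) (X : Set V) (R : V) :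
    ∑ x, ind (x ∈ X) * adjM G R x = (nbrCount G X R : ℚ) := by
  simp only [adjM, ind_and, sum_ind, nbrCount]
  congr 2
  ext x
  simp [and_comm]

theorem adjM_comm (G : SimpleGraph V) (i j : V) : adjM G i j = adjM G j i := by
  simp [adjM, G.adj_comm]

theorem nbrCount_eq_zero [Finite V] {G : SimpleGraph V} {X : Set V} {R : V} (h : nbrCount G X R = 0) {S : V}
    (hS : S ∈ X) : ¬ G.Adj R S := fun h' => by
  rw [nbrCount, Set.ncard_eq_zero] at h
  exact (h ▸ (⟨h', hS⟩ : S ∈ G.neighborSet R ∩ X) : S ∈ (∅ : Set V))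

theorem nbrCount_eq_card [Finite V] {G : SimpleGraph V} {X : Set V} {R : V} (h : nbrCount G X R = X.ncard)
    {S : V} (hS : S ∈ X) : G.Adj R S := by
  have := Set.eq_of_subset_of_ncard_le (Set.inter_subset_right (s := G.neighborSet R) (t := X))
    h.ge
  rw [← this] at hS
  exact hS.1

variable {G : SimpleGraph V} {X Y : Set V}

theorem IsTwoPartition.mem_right (h : IsTwoPartition X Y) {P : V} : P ∈ Y ↔ P ∉ X := by
  constructor
  · exact fun hY hX => Set.disjoint_left.1 h.disjoint hX hY
  · intro hX
    have : P ∈ X ∪ Y := h.union_eq ▸ Set.mem_univ P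
    exact this.resolve_left hX

theorem switchedGraph_adj_of_not {R S : V} (h : ¬ (Switches G X Y R S ∨ Switches G X Y S R)) :
    (switchedGraph G X Y).Adj R S ↔ G.Adj R S := by
  simp only [switchedGraph, h, false_and, not_false_eq_true, true_and, false_or]
  exact ⟨fun h => h.2, fun h => ⟨h.ne, h⟩⟩

theorem switchedGraph_adj_of_switches (hp : IsTwoPartition X Y) {R S : V}
    (h : Switches G X Y R S) : (switchedGraph G X Y).Adj R S ↔ ¬ G.Adj R S := by
  have hne : R ≠ S := by
    rintro rfl
    exact hp.mem_right.1 h.1 h.2.2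
  simp [switchedGraph, h, hne]

theorem nbrCount_switchedGraph_left (hp : IsTwoPartition X Y) {R : V} (hR : R ∈ X) :
    nbrCount (switchedGraph G X Y) X R = nbrCount G X R := by
  unfold nbrCount
  congr 1
  ext S
  simp only [Set.mem_inter_iff, SimpleGraph.mem_neighborSet, and_congr_left_iff]
  intro hS
  refine switchedGraph_adj_of_not ?_
  rintro (h | h)
  · exact hp.mem_right.1 h.1 hR
  · exact hp.mem_right.1 h.1 hS

theorem nbrCount_switchedGraph_right [Finite V] (hp : IsTwoPartition X Y) {R : V} (hR : R ∈ Y) :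
    nbrCount (switchedGraph G X Y) X R = nbrCount G X R := by
  by_cases h : 2 * nbrCount G X R = X.ncard
  · have h1 : (switchedGraph G X Y).neighborSet R ∩ X = X \ (G.neighborSet R ∩ X) := by
      ext S
      simp only [Set.mem_inter_iff, SimpleGraph.mem_neighborSet, Set.mem_sdiff, not_and]
      constructor
      · rintro ⟨h1, h2⟩
        exact ⟨h2, fun h3 => absurd h3 ((switchedGraph_adj_of_switches hp ⟨hR, h, h2⟩).1 h1)⟩
      · rintro ⟨h1, h2⟩
        exact ⟨(switchedGraph_adj_of_switches hp ⟨hR, h, h1⟩).2 fun h3 => h2 h3 h1, h1⟩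
    have h2 := Set.ncard_sdiff_add_ncard_of_subset
      (Set.inter_subset_right (s := G.neighborSet R) (t := X))
    unfold nbrCount at h ⊢
    rw [h1]
    omega
  · unfold nbrCount
    congr 1
    ext S
    simp only [Set.mem_inter_iff, SimpleGraph.mem_neighborSet, and_congr_left_iff]
    intro hS
    refine switchedGraph_adj_of_not ?_
    rintro (h' | h')
    · exact h h'.2.1
    · exact hp.mem_right.1 h'.1 hS

/-- One formula covers the three allowed counts: the correction term is 0, 1 or 2 when `j` has no,
half or all of its possible neighbours in `X`. -/
theorem adjM_switchedGraph_cross [Finite V] (hG : IsGodsilMcKayPartition G X Y) {j i : V}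
    (hjY : j ∈ Y) (hi : i ∈ X) :
    adjM (switchedGraph G X Y) j i = - adjM G j i + 2 / X.ncard * nbrCount G X j := by
  have hp := hG.partition
  have hc := ncard_ne_zero_rat hp.nonempty_left
  by_cases h2 : 2 * nbrCount G X j = X.ncard
  · have h3 := switchedGraph_adj_of_switches hp ⟨hjY, h2, hi⟩
    have h4 : (2 / X.ncard * nbrCount G X j : ℚ) = 1 := by
      have : (2 * nbrCount G X j : ℚ) = X.ncard := by exact_mod_cast h2
      field_simp
      exact this
    rw [h4]
    by_cases h5 : G.Adj j i
    · simp only [adjM, ind_true h5, ind_false (fun h => h3.1 h h5)]; norm_num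
    · simp only [adjM, ind_false h5, ind_true (h3.2 h5)]; norm_num
  · have h3 : adjM (switchedGraph G X Y) j i = adjM G j i := by
      simp only [adjM]
      congr 1
      refine propext (switchedGraph_adj_of_not ?_)
      rintro (h | h)
      · exact h2 h.2.1
      · exact hp.mem_right.1 hjY h.2.2
    rw [h3]
    rcases hG.count j hjY with h | h | h
    · simp [adjM, ind_false (nbrCount_eq_zero h hi), h]
    · exact absurd h h2
    · rw [h]
      simp only [adjM, ind_true (nbrCount_eq_card h hi)]
      field_simp
      norm_num

/-- Checked on the four blocks. The block `X × X` needs regularity, the mixed blocks need the cross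
formula, and for rows in `Y` also the fact that switching keeps the number of neighbours in `X`. -/
theorem adjM_switchedGraph_mul [Fintype V] (hG : IsGodsilMcKayPartition G X Y) :
    adjM (switchedGraph G X Y) * switchM X = switchM X * adjM G := by
  have hp := hG.partition
  have hc := ncard_ne_zero_rat hp.nonempty_left
  obtain ⟨d, hd⟩ := hG.regular
  ext i j
  rw [Matrix.mul_apply, Matrix.mul_apply, sum_switchM_mul, sum_mul_switchM, sum_ind_mul_adj]
  simp only [adjM_comm G _ j]
  rw [sum_ind_mul_adj]
  by_cases hi : i ∈ X <;> by_cases hj : j ∈ X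
  · have : adjM (switchedGraph G X Y) i j = adjM G j i := by
      simp only [adjM, G.adj_comm j i]
      congr 1
      refine propext (switchedGraph_adj_of_not ?_)
      rintro (h | h)
      · exact hp.mem_right.1 h.1 hi
      · exact hp.mem_right.1 h.1 hj
    rw [this, nbrCount_switchedGraph_left hp hi, hd i hi, hd j hj, ind_true hi, ind_true hj]
  · have hjY := hp.mem_right.2 hj
    rw [ind_true hi, ind_false hj]
    have key := adjM_switchedGraph_cross hG hjY hi
    rw [adjM_comm] at key
    rw [key]
    ring
  · have hiY := hp.mem_right.2 hi
    rw [ind_true hj, ind_false hi, nbrCount_switchedGraph_right hp hiY]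
    have key := adjM_switchedGraph_cross hG hiY hj
    rw [key, adjM_comm G j i]
    ring
  · rw [ind_false hi, ind_false hj]
    have : adjM (switchedGraph G X Y) i j = adjM G j i := by
      simp only [adjM, G.adj_comm j i]
      congr 1
      refine propext (switchedGraph_adj_of_not ?_)
      rintro (h | h)
      · exact hj h.2.2
      · exact hi h.2.2
    rw [this]
    ring

/-- Godsil-McKay switching preserves strong regularity and its parameters. -/
theorem isSRG_switchedGraph [Finite V] (hG : IsGodsilMcKayPartition G X Y) {v k l m : ℕ}
    (h : IsSRG G v k l m) : IsSRG (switchedGraph G X Y) v k l m := by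
  let := Fintype.ofFinite V
  let := Classical.decEq V
  rw [isSRG_iff_matrix] at h ⊢
  refine ⟨h.1, ?_⟩
  have hX := hG.partition.nonempty_left
  have h1 := switchM_mul_self hX
  have h2 := adjM_switchedGraph_mul hG
  have h3 : adjM (switchedGraph G X Y) = switchM X * adjM G * switchM X := by
    rw [← h2, mul_assoc, h1, mul_one]
  -- Conjugation fixes `I` and `J`, so it acts on the right-hand side only through `A`.
  have h4 : switchM X * srgM (adjM G) k l m * switchM X =
      srgM (switchM X * adjM G * switchM X) k l m := by
    simp only [srgM, mul_add, add_mul, mul_sub, sub_mul, Matrix.mul_smul, Matrix.smul_mul,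
      mul_one, switchM_mul_ones hX, ones_mul_switchM hX]
    rw [show switchM X * switchM X = _ from h1]
  calc adjM (switchedGraph G X Y) * adjM (switchedGraph G X Y)
      = switchM X * adjM G * (switchM X * switchM X) * adjM G * switchM X := by
        rw [h3]; simp only [mul_assoc]
    _ = switchM X * (adjM G * adjM G) * switchM X := by
        rw [h1]; simp only [mul_assoc, one_mul]
    _ = srgM (adjM (switchedGraph G X Y)) k l m := by rw [h.2, h4, h3]

end Graph
-- Isotropic subspaces and their orthogonals.
section Form

open QuadraticMap

variable {F V : Type*} [Field F] [AddCommGroup V] [Module F V] (Q : QuadraticForm F V)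

/-- The subspace orthogonal to `α` with respect to the polar form of `Q`. -/
def perp (α : Submodule F V) : Submodule F V where
  carrier := {v | ∀ a ∈ α, polar Q v a = 0}
  zero_mem' a _ := polar_zero_left Q a
  add_mem' hx hy a ha := by rw [polar_add_left, hx a ha, hy a ha, add_zero]
  smul_mem' c x hx a ha := by rw [polar_smul_left, hx a ha, smul_zero]

/-- The singular vectors orthogonal to `α`. -/
def sing (α : Submodule F V) : Set V := {v | v ∈ perp Q α ∧ Q v = 0}

variable {Q}

theorem mem_perp {α : Submodule F V} {v : V} : v ∈ perp Q α ↔ ∀ a ∈ α, polar Q v a = 0 := Iff.rfl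

theorem mem_sing {α : Submodule F V} {v : V} : v ∈ sing Q α ↔ v ∈ perp Q α ∧ Q v = 0 := Iff.rfl

theorem mem_perp_bot (v : V) : v ∈ perp Q ⊥ := by
  simp [mem_perp]

theorem mem_perp_span_singleton {v p : V} : v ∈ perp Q (F ∙ p) ↔ polar Q v p = 0 := by
  rw [mem_perp]
  refine ⟨fun h => h p (Submodule.mem_span_singleton_self p), fun h a ha => ?_⟩
  obtain ⟨c, rfl⟩ := Submodule.mem_span_singleton.1 ha
  rw [polar_smul_right, h, smul_zero]

theorem map_add_eq (x y : V) : Q (x + y) = Q x + Q y + polar Q x y := by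
  simp [polar]

theorem polar_eq_zero_of_isotropic {W : Submodule F V} (hW : ∀ w ∈ W, Q w = 0) {x y : V}
    (hx : x ∈ W) (hy : y ∈ W) : polar Q x y = 0 := by
  simp [polar, hW x hx, hW y hy, hW _ (W.add_mem hx hy)]

theorem isotropic_le_perp {W α : Submodule F V} (hW : ∀ w ∈ W, Q w = 0) (h : α ≤ W) :
    W ≤ perp Q α := fun _ hx _ ha => polar_eq_zero_of_isotropic hW hx (h ha)

theorem isotropic_sup {α : Submodule F V} (hα : ∀ a ∈ α, Q a = 0) {p : V} (hp : p ∈ sing Q α) :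
    ∀ w ∈ α ⊔ F ∙ p, Q w = 0 := by
  intro w hw
  obtain ⟨a, ha, b, hb, rfl⟩ := Submodule.mem_sup.1 hw
  obtain ⟨c, rfl⟩ := Submodule.mem_span_singleton.1 hb
  rw [map_add_eq, hα a ha, QuadraticMap.map_smul, hp.2, polar_smul_right, polar_comm, hp.1 a ha]
  simp

theorem add_mem_sing {α : Submodule F V} (hα : ∀ a ∈ α, Q a = 0) {a v : V} (ha : a ∈ α)
    (hv : v ∈ sing Q α) : v + a ∈ sing Q α := by
  refine ⟨Submodule.add_mem _ hv.1 (isotropic_le_perp hα le_rfl ha), ?_⟩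
  rw [map_add_eq, hv.2, hα a ha, hv.1 a ha]
  simp

/-- In characteristic 2 the polar form may be degenerate even though the quadric is non-singular; a
singular vector in its kernel still lies in the radical of `Q`. -/
theorem exists_polar_ne_zero_of_radical (hQ : Q.radical = ⊥) {a : V} (ha : Q a = 0) (h0 : a ≠ 0) :
    ∃ w, polar Q a w ≠ 0 := by
  by_contra! h
  refine h0 ((Submodule.mem_bot F).1 (hQ ▸ QuadraticMap.mem_radical_iff'.2 ⟨ha, fun w => ?_⟩))
  rw [map_add_eq, ha, h, zero_add, add_zero]

/-- A singular vector orthogonal to the isotropic subspace `α` and not in `α` is not orthogonal to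
all of `α^⊥`. -/
theorem exists_mem_perp_polar_ne_zero [FiniteDimensional F V] (hQ : Q.radical = ⊥)
    {α : Submodule F V} (hα : ∀ a ∈ α, Q a = 0) {p : V} (hp : p ∈ sing Q α) (hpα : p ∉ α) :
    ∃ u ∈ perp Q α, polar Q u p ≠ 0 := by
  by_contra! h
  -- If `p` is orthogonal to all of `α^⊥`, the functional `B(p, ·)` vanishes on the common kernel of
  -- the `B(a, ·)`. It is thus some `B(a, ·)` with `a ∈ α`, and `p - a` is a singular vector
  -- orthogonal to everything.
  have h1 : Q.polarBilin p ∈ Submodule.span F (Set.range fun a : α => Q.polarBilin a) := by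
    refine FiniteDimensional.mem_span_of_iInf_ker_le_ker fun u hu => ?_
    simp only [Submodule.mem_iInf, LinearMap.mem_ker, polarBilin_apply_apply] at hu ⊢
    rw [polar_comm]
    exact h u fun a ha => by rw [polar_comm]; exact hu ⟨a, ha⟩
  have h2 : (Set.range fun a : α => Q.polarBilin a) = Q.polarBilin '' α := by
    ext; simp
  rw [h2, ← Submodule.map_span, Submodule.span_eq] at h1
  obtain ⟨a, ha, hap⟩ := h1
  have h3 : p - a ≠ 0 := fun h => hpα (sub_eq_zero.1 h ▸ ha)
  have h4 : Q (p - a) = 0 := by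
    rw [sub_eq_add_neg]
    exact (add_mem_sing hα (α.neg_mem ha) hp).2
  obtain ⟨w, hw⟩ := exists_polar_ne_zero_of_radical hQ h4 h3
  refine hw ?_
  have := LinearMap.congr_fun hap w
  simp only [polarBilin_apply_apply] at this
  rw [polar_sub_left, this, sub_self]

/-- If some isotropic subspace has larger dimension than `α`, then there is a singular vector
orthogonal to `α` and not in `α`. -/
theorem exists_mem_sing_notMem [FiniteDimensional F V] {α W : Submodule F V}
    (hW : ∀ w ∈ W, Q w = 0)
    (h : Module.finrank F α < Module.finrank F W) : ∃ p ∈ sing Q α, p ∉ α := by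
  by_contra! hc
  -- Under the contrary assumption the kernel of `W → α*` lies in `W ∩ α`, while its range
  -- annihilates `W ∩ α`. Rank-nullity then gives `dim W ≤ dim α`.
  let f : W →ₗ[F] Module.Dual F α := (Submodule.dualRestrict α) ∘ₗ Q.polarBilin ∘ₗ W.subtype
  have hf : ∀ w a, f w a = polar Q (w : V) a := fun w a => rfl
  have hker : f.ker ≤ α.comap W.subtype := fun w hw =>
    hc w ⟨fun a ha => by rw [← hf w ⟨a, ha⟩, LinearMap.mem_ker.1 hw]; rfl, hW w w.2⟩
  have hrange : f.range ≤ (W.comap α.subtype).dualAnnihilator := by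
    rintro _ ⟨w, rfl⟩
    rw [Submodule.mem_dualAnnihilator]
    intro a ha
    rw [hf]
    exact polar_eq_zero_of_isotropic hW w.2 ha
  have h1 := Submodule.finrank_mono hker
  have h2 := Submodule.finrank_mono hrange
  have h3 := Subspace.finrank_add_finrank_dualAnnihilator_eq (W.comap α.subtype)
  have h4 := f.finrank_range_add_finrank_ker
  have h5 : Module.finrank F (α.comap W.subtype) = Module.finrank F (W.comap α.subtype) := by
    rw [← LinearMap.finrank_range_of_inj (f := W.subtype ∘ₗ (α.comap W.subtype).subtype)
      (W.injective_subtype.comp (Submodule.injective_subtype _)),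
      ← LinearMap.finrank_range_of_inj (f := α.subtype ∘ₗ (W.comap α.subtype).subtype)
      (α.injective_subtype.comp (Submodule.injective_subtype _)),
      LinearMap.range_comp, LinearMap.range_comp, Submodule.range_subtype, Submodule.range_subtype,
      Submodule.map_comap_subtype, Submodule.map_comap_subtype, inf_comm]
  omega

/-! ### Counting by translation, and the field with two elements. -/

theorem ncard_eq_ncard_add_ncard_not {V : Type*} [Finite V] (S : Set V) (p : V → Prop) :
    S.ncard = {v ∈ S | p v}.ncard + {v ∈ S | ¬ p v}.ncard := by
  rw [← Set.ncard_union_eq (Set.disjoint_left.2 fun v h h' => h'.2 h.2)]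
  congr 1
  ext v
  by_cases h : p v <;> simp [h]

/-- A property that is flipped by a translation holds on half of the set. -/
theorem two_mul_ncard_of_translate [Finite V] {S : Set V} (t : V) (p : V → Prop)
    (hS : ∀ v ∈ S, v + t ∈ S) (hp : ∀ v ∈ S, (p (v + t) ↔ ¬ p v)) :
    2 * {v ∈ S | p v}.ncard = S.ncard := by
  rw [ncard_eq_ncard_add_ncard_not S p, two_mul]
  congr 1
  refine le_antisymm ?_ ?_
  · exact Set.ncard_le_ncard_of_injOn (· + t)
      (fun v hv => ⟨hS v hv.1, fun h => (hp v hv.1).1 h hv.2⟩) (fun a _ b _ h => by simpa using h)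
  · exact Set.ncard_le_ncard_of_injOn (· + t)
      (fun v hv => ⟨hS v hv.1, (hp v hv.1).2 hv.2⟩) (fun a _ b _ h => by simpa using h)

theorem eq_one_of_card_eq_two (h2 : Nat.card F = 2) {c : F} (hc : c ≠ 0) : c = 1 := by
  have : Finite F := Nat.finite_of_card_ne_zero (by omega)
  by_contra h
  have h3 : ({0, 1, c} : Set F).ncard = 3 :=
    Set.ncard_eq_three.2 ⟨0, 1, c, zero_ne_one, hc.symm, Ne.symm h, rfl⟩
  have := Set.ncard_le_card ({0, 1, c} : Set F)
  omega

theorem add_one_eq_zero_iff (h2 : Nat.card F = 2) (c : F) : c + 1 = 0 ↔ ¬ c = 0 := by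
  have h11 : (1 + 1 : F) = 0 := by
    by_contra h
    have := eq_one_of_card_eq_two h2 h
    simp at this
  constructor
  · rintro h rfl
    simp at h
  · intro h
    rw [eq_one_of_card_eq_two h2 h, h11]

theorem polar_add_eq_zero_iff (h2 : Nat.card F = 2) {a p : V} (ha : polar Q a p ≠ 0) (v : V) :
    polar Q (v + a) p = 0 ↔ ¬ polar Q v p = 0 := by
  rw [polar_add_left, eq_one_of_card_eq_two h2 ha, add_one_eq_zero_iff h2]

/-- Over the field with two elements, the number of singular vectors in a hyperplane of `α^⊥`
tangent at a point outside `α`. -/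
theorem four_mul_ncard_add [Finite V] (h2 : Nat.card F = 2) (hQ : Q.radical = ⊥)
    {α : Submodule F V} (hα : ∀ a ∈ α, Q a = 0) {p : V} (hp : p ∈ sing Q α) (hpα : p ∉ α) :
    4 * {v ∈ sing Q α | polar Q v p = 0}.ncard + (perp Q α : Set V).ncard =
      4 * (sing Q α).ncard := by
  have : FiniteDimensional F V := Module.Finite.of_finite
  obtain ⟨u, hu, hup⟩ := exists_mem_perp_polar_ne_zero hQ hα hp hpα
  have h3 := two_mul_ncard_of_translate (S := (perp Q α : Set V)) u (fun v => polar Q v p = 0)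
    (fun v hv => Submodule.add_mem _ hv hu) (fun v _ => polar_add_eq_zero_iff h2 hup v)
  have h4 := ncard_eq_ncard_add_ncard_not (perp Q α : Set V) (fun v => polar Q v p = 0)
  -- Where `B(v, p) = 1`, adding `p` keeps that value and changes `Q v` by 1, so exactly a quarter
  -- of `α^⊥` is singular and not orthogonal to `p`.
  have h5 := two_mul_ncard_of_translate (S := {v ∈ (perp Q α : Set V) | ¬ polar Q v p = 0}) p
    (fun v => Q v = 0) (fun v hv => ⟨Submodule.add_mem _ hv.1 hp.1, by
      rw [polar_add_left, polar_self, hp.2, smul_zero, add_zero]; exact hv.2⟩)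
    (fun v hv => by
      rw [map_add_eq, hp.2, add_zero, eq_one_of_card_eq_two h2 hv.2, add_one_eq_zero_iff h2])
  have h6 := ncard_eq_ncard_add_ncard_not (sing Q α) (fun v => polar Q v p = 0)
  have h7 : {v ∈ sing Q α | ¬ polar Q v p = 0} =
      {v ∈ {v ∈ (perp Q α : Set V) | ¬ polar Q v p = 0} | Q v = 0} := by
    ext v
    simp only [mem_sing, Set.mem_ofPred_eq, SetLike.mem_coe]
    tauto
  rw [h7] at h6
  omega

theorem two_mul_ncard_perp [Finite V] (h2 : Nat.card F = 2) (hQ : Q.radical = ⊥) {p : V}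
    (hp : Q p = 0) (h0 : p ≠ 0) :
    2 * (perp Q (F ∙ p) : Set V).ncard = Nat.card V := by
  obtain ⟨w, hw⟩ := exists_polar_ne_zero_of_radical hQ hp h0
  rw [polar_comm] at hw
  have := two_mul_ncard_of_translate (S := Set.univ) w (fun v => polar Q v p = 0)
    (fun v _ => Set.mem_univ _) (fun v _ => polar_add_eq_zero_iff h2 hw v)
  rw [Set.ncard_univ] at this
  rw [← this]
  congr 2
  ext v
  simp [mem_perp_span_singleton]

end Form

/-! ### From points to vectors, and the part `X_s`. -/

section Points

open QuadraticMap

variable {F : Type*} [Field F] {n : ℕ} {Q : QuadraticForm F (Fin (n + 1) → F)}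

theorem submodule_le_iff (P : ℙ F (Fin (n + 1) → F)) (W : Submodule F (Fin (n + 1) → F)) :
    P.submodule ≤ W ↔ P.rep ∈ W := by
  rw [P.submodule_eq, Submodule.span_singleton_le_iff_mem]

theorem QuadricPoint.map_rep (P : QuadricPoint Q) : Q P.1.rep = 0 :=
  P.2 _ ((submodule_le_iff P.1 _).1 le_rfl)

/-- The point of the quadric spanned by a non-zero singular vector. -/
def toPoint {v : Fin (n + 1) → F} (h0 : v ≠ 0) (hv : Q v = 0) : QuadricPoint Q :=
  ⟨Projectivization.mk F v h0, fun w hw => by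
    rw [Projectivization.submodule_mk] at hw
    obtain ⟨c, rfl⟩ := Submodule.mem_span_singleton.1 hw
    rw [QuadraticMap.map_smul, hv, smul_zero]⟩

theorem exists_rep_toPoint {v : Fin (n + 1) → F} (h0 : v ≠ 0) (hv : Q v = 0) :
    ∃ c : F, c ≠ 0 ∧ (toPoint h0 hv).1.rep = c • v := by
  obtain ⟨c, hc⟩ := Projectivization.exists_smul_eq_mk_rep F v h0
  exact ⟨c, c.ne_zero, hc.symm⟩

theorem rep_injective : Function.Injective fun P : QuadricPoint Q => P.1.rep := by
  intro P R h
  refine Subtype.ext ?_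
  rw [← P.1.mk_rep, ← R.1.mk_rep]
  congr 1

theorem pointGraph_adj {P R : QuadricPoint Q} :
    (pointGraph Q).Adj P R ↔ P ≠ R ∧ polar Q P.1.rep R.1.rep = 0 := by
  refine and_congr_right fun _ => ?_
  constructor
  · intro h
    exact polar_eq_zero_of_isotropic h
      (Submodule.mem_sup_left ((submodule_le_iff P.1 _).1 le_rfl))
      (Submodule.mem_sup_right ((submodule_le_iff R.1 _).1 le_rfl))
  · intro h
    rw [R.1.submodule_eq]
    refine isotropic_sup P.2 ⟨?_, R.map_rep⟩
    rw [P.1.submodule_eq, mem_perp_span_singleton, polar_comm, h]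

/-- For `P` outside `α`, the join of `α` and `P` has projective dimension `s + 1`, and it is
contained in the quadric once `P` is orthogonal to `α`. -/
theorem mem_partX {s : ℕ} {α : Submodule F (Fin (n + 1) → F)} (hα : IsSpaceOf Q s α)
    {P : QuadricPoint Q} : P ∈ partX Q s α ↔ P.1.rep ∈ sing Q α \ α := by
  simp only [partX, typeTwo, submodule_le_iff, Set.mem_ofPred_eq, Set.mem_sdiff, SetLike.mem_coe]
  rw [and_comm]
  refine and_congr_left fun hP => ?_
  constructor
  · rintro ⟨W, hW, hαW, hPW⟩
    exact ⟨isotropic_le_perp hW.2 hαW hPW, P.map_rep⟩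
  · intro h
    refine ⟨α ⊔ F ∙ P.1.rep, ⟨?_, isotropic_sup hα.2 h⟩, le_sup_left,
      Submodule.mem_sup_right (Submodule.mem_span_singleton_self _)⟩
    have h1 := Submodule.finrank_sup_add_finrank_inf_eq α (F ∙ P.1.rep)
    have h2 : α ⊓ F ∙ P.1.rep = ⊥ := by
      rw [← disjoint_iff, Submodule.disjoint_span_singleton' P.1.rep_nonzero]
      exact hP
    rw [h2, finrank_bot, finrank_span_singleton P.1.rep_nonzero, hα.1] at h1
    omega

theorem mem_partY {s : ℕ} {α : Submodule F (Fin (n + 1) → F)} {P : QuadricPoint Q} :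
    P ∈ partY Q s α ↔ P ∉ partX Q s α := by
  simp only [partY, partX, typeThree, Set.mem_union, Set.mem_compl_iff, not_or]
  constructor
  · rintro (h | h)
    · exact fun h' => h'.1 h
    · exact h.2
  · intro h
    by_cases h' : P ∈ typeOne Q α
    · exact Or.inl h'
    · exact Or.inr ⟨h', h⟩

theorem toPoint_mem_partX {s : ℕ} {α : Submodule F (Fin (n + 1) → F)} (hα : IsSpaceOf Q s α)
    {v : Fin (n + 1) → F} (hv : v ∈ sing Q α) (hvα : v ∉ α) (h0 : v ≠ 0) :
    toPoint h0 hv.2 ∈ partX Q s α := by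
  rw [mem_partX hα]
  obtain ⟨c, hc, h⟩ := exists_rep_toPoint h0 hv.2
  refine ⟨⟨?_, (toPoint h0 hv.2).map_rep⟩, ?_⟩
  · rw [h]
    exact Submodule.smul_mem _ _ hv.1
  · rwa [h, SetLike.mem_coe, Submodule.smul_mem_iff _ hc]

theorem isTwoPartition {g : ℕ} (hg : HasProjectiveIndex Q g) {s : ℕ} (hs : s < g)
    {α : Submodule F (Fin (n + 1) → F)} (hα : IsSpaceOf Q s α) :
    IsTwoPartition (partX Q s α) (partY Q s α) where
  nonempty_left := by
    obtain ⟨W, hW⟩ := hg.1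
    obtain ⟨p, hp, hpα⟩ := exists_mem_sing_notMem hW.2 (by rw [hα.1, hW.1]; omega)
    have h0 : p ≠ 0 := fun h => hpα (h ▸ α.zero_mem)
    exact ⟨_, toPoint_mem_partX hα hp hpα h0⟩
  nonempty_right := by
    have h1 : α ≠ ⊥ := by
      rintro rfl
      have := hα.1
      rw [finrank_bot] at this
      omega
    obtain ⟨a, ha, h0⟩ := Submodule.exists_mem_ne_zero_of_ne_bot h1
    refine ⟨toPoint h0 (hα.2 a ha), mem_partY.2 fun h => ((mem_partX hα).1 h).2 ?_⟩
    obtain ⟨c, hc, h⟩ := exists_rep_toPoint h0 (hα.2 a ha)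
    rw [h]
    exact α.smul_mem c ha
  disjoint := Set.disjoint_left.2 fun _ h h' => mem_partY.1 h' h
  union_eq := by
    ext P
    simp only [Set.mem_union, mem_partY, Set.mem_univ, iff_true]
    exact em _

/-! ### The case `q = 2`. -/

theorem rep_toPoint (h2 : Nat.card F = 2) {v : Fin (n + 1) → F} (h0 : v ≠ 0) (hv : Q v = 0) :
    (toPoint h0 hv).1.rep = v := by
  obtain ⟨c, hc, h⟩ := exists_rep_toPoint h0 hv
  rw [h, eq_one_of_card_eq_two h2 hc, one_smul]

theorem ncard_points (h2 : Nat.card F = 2) {T : Set (QuadricPoint Q)} {S : Set (Fin (n + 1) → F)}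
    (hS : ∀ v ∈ S, v ≠ 0 ∧ Q v = 0) (h : ∀ P : QuadricPoint Q, P ∈ T ↔ P.1.rep ∈ S) :
    T.ncard = S.ncard := by
  rw [← Set.ncard_image_of_injective T rep_injective]
  congr 1
  ext v
  constructor
  · rintro ⟨P, hP, rfl⟩
    exact (h P).1 hP
  · intro hv
    refine ⟨toPoint (hS v hv).1 (hS v hv).2, (h _).2 ?_, rep_toPoint h2 _ _⟩
    rwa [rep_toPoint h2]

theorem mem_sing_bot {v : Fin (n + 1) → F} : v ∈ sing Q ⊥ ↔ Q v = 0 := by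
  simp [mem_sing, mem_perp_bot]

theorem mem_sing_span_singleton {v p : Fin (n + 1) → F} :
    v ∈ sing Q (F ∙ p) ↔ polar Q v p = 0 ∧ Q v = 0 := by
  rw [mem_sing, mem_perp_span_singleton]

theorem QuadricPoint.isotropic_span (P : QuadricPoint Q) : ∀ a ∈ F ∙ P.1.rep, Q a = 0 := by
  rw [← P.1.submodule_eq]
  exact P.2

theorem polar_rep_self (P : QuadricPoint Q) : polar Q P.1.rep P.1.rep = 0 := by
  rw [polar_self, P.map_rep, smul_zero]

/-- The 2 accounts for the zero vector and `P` itself. -/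
theorem ncard_neighborSet [Finite F] (h2 : Nat.card F = 2) (P : QuadricPoint Q) :
    ((pointGraph Q).neighborSet P).ncard + 2 =
      {v ∈ sing Q ⊥ | polar Q v P.1.rep = 0}.ncard := by
  have h := ncard_points (Q := Q) h2 (T := (pointGraph Q).neighborSet P)
    (S := {v ∈ sing Q ⊥ | polar Q v P.1.rep = 0} \ {0, P.1.rep})
    (fun v hv => ⟨fun h => hv.2 (by simp [h]), hv.1.1.2⟩) fun R => by
      simp only [SimpleGraph.mem_neighborSet, pointGraph_adj, Set.mem_sdiff, Set.mem_ofPred_eq,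
        mem_sing_bot, R.map_rep, true_and, Set.mem_insert_iff, Set.mem_singleton_iff,
        R.1.rep_nonzero, false_or, rep_injective.eq_iff (a := R) (b := P)]
      rw [polar_comm, ne_comm, and_comm]
  rw [h, ← Set.ncard_pair P.1.rep_nonzero.symm]
  refine Set.ncard_sdiff_add_ncard_of_subset ?_
  rintro v (rfl | rfl)
  · exact ⟨mem_sing_bot.2 (by simp), polar_zero_left Q _⟩
  · exact ⟨mem_sing_bot.2 P.map_rep, polar_rep_self P⟩

theorem ncard_inter_neighborSet_of_adj [Finite F] (h2 : Nat.card F = 2) {P R : QuadricPoint Q}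
    (hPR : (pointGraph Q).Adj P R) :
    ((pointGraph Q).neighborSet P ∩ (pointGraph Q).neighborSet R).ncard + 3 =
      {v ∈ sing Q (F ∙ P.1.rep) | polar Q v R.1.rep = 0}.ncard := by
  have hPR' := pointGraph_adj.1 hPR
  have h := ncard_points (Q := Q) h2
    (T := (pointGraph Q).neighborSet P ∩ (pointGraph Q).neighborSet R)
    (S := {v ∈ sing Q (F ∙ P.1.rep) | polar Q v R.1.rep = 0} \ {0, P.1.rep, R.1.rep})
    (fun v hv => ⟨fun h => hv.2 (by simp [h]), hv.1.1.2⟩) fun T => by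
      simp only [SimpleGraph.mem_neighborSet, pointGraph_adj, Set.mem_sdiff, Set.mem_ofPred_eq,
        mem_sing_span_singleton, T.map_rep, and_true, Set.mem_insert_iff, Set.mem_singleton_iff,
        T.1.rep_nonzero, false_or, rep_injective.eq_iff (a := T) (b := P),
        rep_injective.eq_iff (a := T) (b := R), Set.mem_inter_iff]
      rw [polar_comm, ne_comm, polar_comm Q R.1.rep, ne_comm (a := R)]
      tauto
  rw [h, ← Set.ncard_eq_three.2 ⟨0, P.1.rep, R.1.rep, P.1.rep_nonzero.symm,
    R.1.rep_nonzero.symm, fun h => hPR'.1 (rep_injective h), rfl⟩]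
  refine Set.ncard_sdiff_add_ncard_of_subset ?_
  rintro v (rfl | rfl | rfl)
  · exact ⟨mem_sing_span_singleton.2 ⟨polar_zero_left Q _, by simp⟩, polar_zero_left Q _⟩
  · exact ⟨mem_sing_span_singleton.2 ⟨polar_rep_self P, P.map_rep⟩, hPR'.2⟩
  · exact ⟨mem_sing_span_singleton.2 ⟨by rw [polar_comm, hPR'.2], R.map_rep⟩, polar_rep_self R⟩

/-- Translation by `P` flips orthogonality to `R` on the singular vectors of `P^⊥`. Only the zero
vector is discarded, since `P` and `R` are not orthogonal to each other. -/
theorem ncard_inter_neighborSet_of_not_adj [Finite F] (h2 : Nat.card F = 2) {P R : QuadricPoint Q}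
    (hne : P ≠ R) (hPR : ¬ (pointGraph Q).Adj P R) :
    2 * (((pointGraph Q).neighborSet P ∩ (pointGraph Q).neighborSet R).ncard + 1) =
      (sing Q (F ∙ P.1.rep)).ncard := by
  have hpol : polar Q P.1.rep R.1.rep ≠ 0 := fun h => hPR (pointGraph_adj.2 ⟨hne, h⟩)
  have hpol' : polar Q R.1.rep P.1.rep ≠ 0 := by rwa [polar_comm]
  have h := ncard_points (Q := Q) h2
    (T := (pointGraph Q).neighborSet P ∩ (pointGraph Q).neighborSet R)
    (S := {v ∈ sing Q (F ∙ P.1.rep) | polar Q v R.1.rep = 0} \ {0})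
    (fun v hv => ⟨fun h => hv.2 (by simp [h]), hv.1.1.2⟩) fun T => by
      simp only [SimpleGraph.mem_neighborSet, pointGraph_adj, Set.mem_sdiff, Set.mem_ofPred_eq,
        mem_sing_span_singleton, T.map_rep, and_true, Set.mem_singleton_iff,
        T.1.rep_nonzero, not_false_eq_true, Set.mem_inter_iff]
      rw [polar_comm, polar_comm Q R.1.rep]
      constructor
      · exact fun h => ⟨h.1.2, h.2.2⟩
      · exact fun h => ⟨⟨fun h' => hpol (h' ▸ h.2), h.1⟩, ⟨fun h' => hpol' (h' ▸ h.1), h.2⟩⟩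
  have h3 := Set.ncard_sdiff_add_ncard_of_subset (s := {0})
    (t := {v ∈ sing Q (F ∙ P.1.rep) | polar Q v R.1.rep = 0}) (by
      rintro v rfl
      exact ⟨mem_sing_span_singleton.2 ⟨polar_zero_left Q _, by simp⟩, polar_zero_left Q _⟩)
  rw [Set.ncard_singleton] at h3
  rw [h, h3]
  exact two_mul_ncard_of_translate P.1.rep _
    (fun v hv => add_mem_sing P.isotropic_span (Submodule.mem_span_singleton_self _) hv)
    (fun v _ => polar_add_eq_zero_iff h2 hpol v)

theorem four_mul_ncard_bot [Finite F] (h2 : Nat.card F = 2) (hQ : IsNonsingular Q)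
    (P : QuadricPoint Q) :
    4 * {v ∈ sing Q ⊥ | polar Q v P.1.rep = 0}.ncard + Nat.card (Fin (n + 1) → F) =
      4 * (sing Q ⊥).ncard := by
  have h := four_mul_ncard_add h2 hQ (α := ⊥) (by simp) (mem_sing_bot.2 P.map_rep)
    (by simpa using P.1.rep_nonzero)
  have h' : (perp Q ⊥ : Set (Fin (n + 1) → F)) = Set.univ := by
    ext v
    simpa using mem_perp_bot v
  rwa [h', Set.ncard_univ] at h

theorem sing_span_singleton (p : Fin (n + 1) → F) :
    sing Q (F ∙ p) = {v ∈ sing Q ⊥ | polar Q v p = 0} := by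
  ext v
  rw [mem_sing_span_singleton, Set.mem_ofPred_eq, mem_sing_bot, and_comm]

theorem exists_isSRG_pointGraph [Finite F] (h2 : Nat.card F = 2) (hQ : IsNonsingular Q) :
    ∃ v k l m : ℕ, IsSRG (pointGraph Q) v k l m := by
  let N := (sing Q ⊥).ncard
  let q := Nat.card (Fin (n + 1) → F)
  -- Here `q` is the number of all vectors. A point's orthogonal contains `N - q/4` singular
  -- vectors, and `N - q/4 - q/8` of those are orthogonal to a given adjacent point; half of `N -
  -- q/4` are orthogonal to a given non-adjacent one.
  refine ⟨_, (4 * N - q) / 4 - 2, (8 * N - 3 * q) / 8 - 3, (4 * N - q) / 8 - 1,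
    (isSRG_iff _ _ _ _ _).2 ⟨rfl, fun P => ?_, fun P R h => ?_, fun P R hne h => ?_⟩⟩
  · have h3 := four_mul_ncard_bot h2 hQ P
    have h4 := ncard_neighborSet h2 P
    omega
  · have h3 := four_mul_ncard_bot h2 hQ P
    have h4 := ncard_inter_neighborSet_of_adj h2 h
    have hPR := pointGraph_adj.1 h
    have h5 := four_mul_ncard_add h2 hQ P.isotropic_span (p := R.1.rep)
      (mem_sing_span_singleton.2 ⟨by rw [polar_comm, hPR.2], R.map_rep⟩) (fun h => by
        obtain ⟨c, hc⟩ := Submodule.mem_span_singleton.1 h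
        have hc0 : c ≠ 0 := by
          rintro rfl
          exact R.1.rep_nonzero (by rw [← hc, zero_smul])
        rw [eq_one_of_card_eq_two h2 hc0, one_smul] at hc
        exact hPR.1 (rep_injective hc))
    have h6 := two_mul_ncard_perp h2 hQ P.map_rep P.1.rep_nonzero
    have h7 := congrArg Set.ncard (sing_span_singleton (Q := Q) P.1.rep)
    omega
  · have h3 := four_mul_ncard_bot h2 hQ P
    have h4 := ncard_inter_neighborSet_of_not_adj h2 hne h
    rw [sing_span_singleton] at h4
    omega

theorem isGodsilMcKayPartition [Finite F] (h2 : Nat.card F = 2) (hQ : IsNonsingular Q) {g : ℕ}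
    (hg : HasProjectiveIndex Q g) {s : ℕ} (hs : s < g)
    {α : Submodule F (Fin (n + 1) → F)} (hα : IsSpaceOf Q s α) :
    IsGodsilMcKayPartition (pointGraph Q) (partX Q s α) (partY Q s α) where
  partition := isTwoPartition hg hs hα
  regular := by
    -- This is the count from `four_mul_ncard_add`, less the vectors of `α` and the vector of `P`.
    refine ⟨(4 * (sing Q α).ncard - (perp Q α : Set (Fin (n + 1) → F)).ncard) / 4 -
      ((α : Set (Fin (n + 1) → F)).ncard + 1), fun P hP => ?_⟩
    rw [mem_partX hα] at hP
    have h3 := four_mul_ncard_add h2 hQ hα.2 hP.1 hP.2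
    have h4 := ncard_points (Q := Q) h2
      (T := (pointGraph Q).neighborSet P ∩ partX Q s α)
      (S := {v ∈ sing Q α | polar Q v P.1.rep = 0} \ insert P.1.rep (α : Set (Fin (n + 1) → F)))
      (fun v hv => ⟨fun h => hv.2 (by simp [h]), hv.1.1.2⟩) fun T => by
        simp only [Set.mem_inter_iff, SimpleGraph.mem_neighborSet, pointGraph_adj, mem_partX hα,
          Set.mem_sdiff, Set.mem_ofPred_eq, Set.mem_insert_iff,
          rep_injective.eq_iff (a := T) (b := P)]
        rw [polar_comm, ne_comm]
        tauto
    have h5 := Set.ncard_sdiff_add_ncard_of_subset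
      (s := insert P.1.rep (α : Set (Fin (n + 1) → F)))
      (t := {v ∈ sing Q α | polar Q v P.1.rep = 0}) (by
        rintro v (rfl | hv)
        · exact ⟨hP.1, polar_rep_self P⟩
        · refine ⟨⟨isotropic_le_perp hα.2 le_rfl hv, hα.2 v hv⟩, ?_⟩
          rw [polar_comm]
          exact hP.1.1 v hv)
    rw [Set.ncard_insert_of_notMem hP.2] at h5
    unfold nbrCount
    omega
  count R hR := by
    by_cases hRα : R.1.rep ∈ perp Q α
    · refine Or.inr (Or.inr ?_)
      have hR' : R.1.rep ∈ α := by
        by_contra h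
        exact mem_partY.1 hR ((mem_partX hα).2 ⟨⟨hRα, R.map_rep⟩, h⟩)
      unfold nbrCount
      congr 1
      refine Set.inter_eq_right.2 fun P hP => ?_
      rw [SimpleGraph.mem_neighborSet, pointGraph_adj]
      refine ⟨fun h => mem_partY.1 hR (h ▸ hP), ?_⟩
      rw [polar_comm]
      exact ((mem_partX hα).1 hP).1.1 _ hR'
    · refine Or.inr (Or.inl ?_)
      rw [mem_perp] at hRα
      push Not at hRα
      obtain ⟨a, ha, haR⟩ := hRα
      rw [polar_comm] at haR
      have h3 := two_mul_ncard_of_translate (S := sing Q α \ α) a (fun v => polar Q v R.1.rep = 0)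
        (fun v hv => ⟨add_mem_sing hα.2 ha hv.1, fun h => hv.2 ((α.add_mem_iff_left ha).1 h)⟩)
        (fun v _ => polar_add_eq_zero_iff h2 haR v)
      have h0 : ∀ v ∈ sing Q α \ (α : Set (Fin (n + 1) → F)), v ≠ 0 ∧ Q v = 0 := fun v hv =>
        ⟨fun h => hv.2 (by simp [h]), hv.1.2⟩
      rw [ncard_points h2 h0 fun P => mem_partX hα, ← h3]
      unfold nbrCount
      congr 1
      refine ncard_points h2 (fun v hv => h0 v hv.1) fun P => ?_
      rw [Set.mem_inter_iff, SimpleGraph.mem_neighborSet, pointGraph_adj, mem_partX hα,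
        Set.mem_ofPred_eq, polar_comm]
      constructor
      · exact fun h => ⟨h.2, h.1.2⟩
      · exact fun h => ⟨⟨fun h' => mem_partY.1 hR (h' ▸ (mem_partX hα).2 h.1), h.2⟩, h.1⟩

/-! ### The case `q ≠ 2`. -/

/-- A point of the quadric not orthogonal to `α` is adjacent to exactly one in `q` points of `X_s`. -/
theorem nbrCount_mul_card [Finite F] {s : ℕ} {α : Submodule F (Fin (n + 1) → F)}
    (hα : IsSpaceOf Q s α) {R : QuadricPoint Q} {a : Fin (n + 1) → F} (ha : a ∈ α)
    (haR : polar Q a R.1.rep ≠ 0) :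
    nbrCount (pointGraph Q) (partX Q s α) R * Nat.card F = (partX Q s α).ncard := by
  have hRX : R ∉ partX Q s α := fun h => haR (by
    rw [polar_comm]; exact ((mem_partX hα).1 h).1.1 a ha)
  have hmem : ∀ (P : QuadricPoint Q) (c : F), P ∈ partX Q s α →
      P.1.rep + c • a ∈ sing Q α ∧ P.1.rep + c • a ∉ α := fun P c hP => by
    rw [mem_partX hα] at hP
    exact ⟨add_mem_sing hα.2 (α.smul_mem c ha) hP.1,
      fun h => hP.2 ((α.add_mem_iff_left (α.smul_mem c ha)).1 h)⟩
  have hne : ∀ (P : QuadricPoint Q) (c : F), P ∈ partX Q s α → P.1.rep + c • a ≠ 0 :=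
    fun P c hP h => (hmem P c hP).2 (h ▸ α.zero_mem)
  unfold nbrCount
  rw [← Nat.card_coe_set_eq, ← Nat.card_coe_set_eq, ← Nat.card_prod]
  -- The bijection sends a neighbour `P ∈ X_s` of `R` and a scalar `c` to the point spanned by `P +
  -- c a`.
  refine Nat.card_congr (Equiv.ofBijective (fun x =>
    ⟨toPoint (hne x.1.1 x.2 x.1.2.2) (hmem x.1.1 x.2 x.1.2.2).1.2,
      toPoint_mem_partX hα (hmem x.1.1 x.2 x.1.2.2).1 (hmem x.1.1 x.2 x.1.2.2).2 _⟩) ⟨?_, ?_⟩)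
  · rintro ⟨⟨P, hP⟩, c⟩ ⟨⟨P', hP'⟩, c'⟩ h
    have h1 : Projectivization.mk F (P.1.rep + c • a) (hne P c hP.2) =
        Projectivization.mk F (P'.1.rep + c' • a) (hne P' c' hP'.2) :=
      congrArg (fun x => x.1.1) h
    obtain ⟨μ, hμ⟩ := (Projectivization.mk_eq_mk_iff' _ _ _ _ _).1 h1
    have hp := (pointGraph_adj.1 hP.1).2
    have hp' := (pointGraph_adj.1 hP'.1).2
    -- Pairing with `R` kills `P` and `P'` and so compares the coefficients of `a`.
    have h2 := congrArg (fun v => polar Q R.1.rep v) hμ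
    simp only [polar_smul_right, polar_add_right, hp, hp', zero_add, smul_eq_mul] at h2
    rw [polar_comm] at haR
    have h3 : μ * c' = c := by
      apply mul_right_cancel₀ haR
      linear_combination h2
    rw [smul_add, smul_smul, h3] at hμ
    have h4 : μ • P'.1.rep = P.1.rep := add_right_cancel hμ
    have h5 : P = P' := by
      refine Subtype.ext ?_
      rw [← P.1.mk_rep, ← P'.1.mk_rep]
      exact (Projectivization.mk_eq_mk_iff' _ _ _ _ _).2 ⟨μ, h4⟩
    subst h5
    have h6 : μ = 1 := by
      have : (μ - 1) • P.1.rep = 0 := by rw [sub_smul, h4, one_smul, sub_self]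
      exact sub_eq_zero.1 ((smul_eq_zero.1 this).resolve_right P.1.rep_nonzero)
    rw [h6, one_mul] at h3
    subst h3
    rfl
  · rintro ⟨P, hP⟩
    have hP' := (mem_partX hα).1 hP
    -- Chosen so that `P - t a` is orthogonal to `R`.
    let t := polar Q P.1.rep R.1.rep / polar Q a R.1.rep
    let v := P.1.rep + (-t) • a
    have hv := hmem P (-t) hP
    have hv0 := hne P (-t) hP
    let T := toPoint hv0 hv.1.2
    have hT : T ∈ partX Q s α := toPoint_mem_partX hα hv.1 hv.2 _
    obtain ⟨c, hc, hTv⟩ := exists_rep_toPoint hv0 hv.1.2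
    have hTR : polar Q R.1.rep T.1.rep = 0 := by
      rw [polar_comm, hTv, polar_smul_left, polar_add_left, polar_smul_left]
      simp only [t, smul_eq_mul]
      field_simp
      ring
    -- The representative of `T` is `c (P - t a)`, so adding `c t a` returns `c P`.
    refine ⟨⟨⟨T, pointGraph_adj.2 ⟨fun h => hRX (h ▸ hT), hTR⟩, hT⟩, c * t⟩, ?_⟩
    refine Subtype.ext (Subtype.ext ?_)
    refine Eq.trans ?_ P.1.mk_rep
    refine (Projectivization.mk_eq_mk_iff' _ _ _ _ _).2 ⟨c, ?_⟩
    change c • P.1.rep = T.1.rep + (c * t) • a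
    rw [hTv, smul_add, smul_smul, add_assoc, ← add_smul]
    simp

theorem not_isGodsilMcKayPartition [Finite F] (h2 : Nat.card F ≠ 2) (hQ : IsNonsingular Q)
    {s : ℕ} {α : Submodule F (Fin (n + 1) → F)} (hα : IsSpaceOf Q s α) :
    ¬ IsGodsilMcKayPartition (pointGraph Q) (partX Q s α) (partY Q s α) := by
  intro h
  have h1 : α ≠ ⊥ := by
    rintro rfl
    have := hα.1
    rw [finrank_bot] at this
    omega
  obtain ⟨a, ha, h0⟩ := Submodule.exists_mem_ne_zero_of_ne_bot h1
  obtain ⟨w, hw⟩ := exists_polar_ne_zero_of_radical hQ (hα.2 a ha) h0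
  -- As `a` is singular, `Q (w + c a) = Q w + c B(a, w)`; this `c` makes it vanish without changing
  -- `B(a, w)`.
  let c := - Q w / polar Q a w
  have haa : polar Q a a = 0 := by rw [polar_self, hα.2 a ha, smul_zero]
  have hr : polar Q a (w + c • a) ≠ 0 := by
    rwa [polar_add_right, polar_smul_right, haa, smul_zero, add_zero]
  have hr0 : w + c • a ≠ 0 := fun h => hr (by rw [h, polar_zero_right])
  have hrQ : Q (w + c • a) = 0 := by
    rw [map_add_eq, QuadraticMap.map_smul, hα.2 a ha, polar_smul_right, polar_comm]
    simp only [c, smul_eq_mul]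
    field_simp
    ring
  obtain ⟨d, hd, hR⟩ := exists_rep_toPoint hr0 hrQ
  have haR : polar Q a (toPoint hr0 hrQ).1.rep ≠ 0 := by
    rw [hR, polar_smul_right]
    exact smul_ne_zero hd hr
  have h3 := nbrCount_mul_card hα ha haR
  have h4 : 0 < (partX Q s α).ncard := (Set.ncard_pos).2 h.partition.nonempty_left
  have h5 : 1 < Nat.card F := Finite.one_lt_card
  have hRY : toPoint hr0 hrQ ∈ partY Q s α := mem_partY.2 fun h => haR (by
    rw [polar_comm]; exact ((mem_partX hα).1 h).1.1 a ha)
  rcases h.count _ hRY with h6 | h6 | h6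
  · rw [h6] at h3
    omega
  · rw [← h6, mul_comm 2] at h3
    exact h2 (Nat.eq_of_mul_eq_mul_left (by omega) h3)
  · rw [h6] at h3
    have := Nat.eq_of_mul_eq_mul_left h4 (h3.trans (mul_one _).symm)
    omega

end Points
end GMQuadric
end

theorem theorem3p2 {F : Type*} [Field F] [Finite F] (n : ℕ)
    (Q : QuadraticForm F (Fin (n + 1) → F)) (hQ : GMQuadric.IsNonsingular Q)
    (g : ℕ) (hg : GMQuadric.HasProjectiveIndex Q g) (s : ℕ) (hs : s < g)
    (α : Submodule F (Fin (n + 1) → F)) (hα : GMQuadric.IsSpaceOf Q s α) :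
    GMQuadric.IsTwoPartition (GMQuadric.partX Q s α) (GMQuadric.partY Q s α) ∧
    (Nat.card F = 2 →
      GMQuadric.IsGodsilMcKayPartition (GMQuadric.pointGraph Q)
        (GMQuadric.partX Q s α) (GMQuadric.partY Q s α) ∧
      (∃ v k l m : ℕ, GMQuadric.IsSRG (GMQuadric.pointGraph Q) v k l m) ∧
      (∀ v k l m : ℕ, GMQuadric.IsSRG (GMQuadric.pointGraph Q) v k l m →
        GMQuadric.IsSRG (GMQuadric.graphGamma Q s α) v k l m)) ∧
    (Nat.card F ≠ 2 →
      ¬ GMQuadric.IsGodsilMcKayPartition (GMQuadric.pointGraph Q)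
        (GMQuadric.partX Q s α) (GMQuadric.partY Q s α)) := by
  exact ⟨GMQuadric.isTwoPartition hg hs hα, fun h2 =>
    ⟨GMQuadric.isGodsilMcKayPartition h2 hQ hg hs hα, GMQuadric.exists_isSRG_pointGraph h2 hQ,
      fun _ _ _ _ h => GMQuadric.isSRG_switchedGraph
        (GMQuadric.isGodsilMcKayPartition h2 hQ hg hs hα) h⟩,
    fun h2 => GMQuadric.not_isGodsilMcKayPartition h2 hQ hα⟩
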